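/- Notation. For a polynomial $f$ and $n\ge 0$ put $(f)_n=f(f-1)\cdots(f-(n-1))$. All identities below hold in the formal power series ring $\mathbb Z[t][[u]]$. For a finite ranked poset $P$ with bottom element $\hat 0$, let $\chi_P(t)=\sum_{x\in P}\mu_P(\hat 0,x)\,t^{\mathrm{rk}(P)-\mathrm{rk}(x)}$, where $\mu_P$ is the Möbius function, $\mathrm{rk}(x)$ is the length of a longest chain from $\hat 0$ to $x$, and $\mathrm{rk}(P)$ is the length of a longest chain of $P$. For a finite arrangement $\mathcal H$ of affine hyperplanes in a space $\mathbb R^d$, let $\mathcal L(\mathcal H)$ be the set of nonempty intersections of subsets of $\mathcal H$ (including $\mathbb R^d$), ordered by reverse containment. The bond lattice $\Pi_G$ of a finite graph $G$ with vertex set $W$ is $\mathcal L$ of the graphic arrangement $\{x_v-x_w=0 : \{v,w\}\in E(G)\}$ in $\mathbb R^W$. The chromatic polynomial $\mathrm{ch}_G(t)$ is the polynomial whose value at each $q\in\mathbb N$ is the number of proper colorings of $G$ with $q$ colors. For a finite set $V$ of positive integers, $\Gamma_V$ is the graph with vertex set $V$ and an edge $\{a,b\}$ whenever $a\in V$ is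 odd, $b\in V$ is even and $a<b$. The partition type $\lambda(V)$ is the integer partition whose parts are the numbers $\#\{a\in V: a \text{ odd},\ a<b\}$ for $b\in V$ even (zeros being ignored). A Ferrers graph is a graph whose vertex set is partitioned into $R=\{r_1,\dots,r_p\}$ and $C=\{c_1,\dots,c_q\}$ $(p,q\ge1)$, all of whose edges join $R$ to $C$, such that if $\{r_i,c_j\}$ is an edge then so is $\{r_l,c_m\}$ for all $l\ge i$, $m\le j$, and such that $\{r_1,c_1\}$ and $\{r_p,c_q\}$ are edges; its associated partition has the degrees of $r_1,\dots,r_p$ as parts. The $k$-staircase with $n$ steps is the partition $\lambda_k^{(n)}=(nk,(n-1)k,\dots,k)$. Theorem. Let $k\ge 1$. (1) For any finite sets $V_1,V_2,\dots$ of positive integers with $\lambda(V_n)=\lambda_k^{(n)}$ for all $n\ge 1$, $$\sum_{n\ge1}\chi_{\Pi_{\Gamma_{V_n}}}(t)\,u^n=\sum_{n\ge1}\frac{(t-1)_{n-1}\,\big((t-1)_n\big)^k\,u^n}{\prod_{i=1}^n\big(1-i(t-i)^k u\big)}.$$ (2) If, for each $n\ge1$, $G_n$ is a Ferrers graph with associated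 partition $\lambda_k^{(n)}$, then $$\sum_{n\ge1}\mathrm{ch}_{G_n}(t)\,u^n=\sum_{n\ge1}\frac{(t)_{n}\,\big((t-1)_n\big)^k\,u^n}{\prod_{i=1}^n\big(1-i(t-i)^k u\big)}.$$ (3) Let $\mathcal H_{n,k}=\{x_i-x_j=y_i^{(\ell)} : 1\le i<j\le n+1,\ 1\le \ell\le k\}$ be the homogenized $(k,\dots,k)$-arrangement in $\mathbb R^{nk+n+1}$, with coordinates $x_1,\dots,x_{n+1}$ and $y_i^{(\ell)}$ $(1\le i\le n,\ 1\le\ell\le k)$. Then $$\sum_{n\ge1}\chi_{\mathcal L(\mathcal H_{n,k})}(t)\,u^n=\sum_{n\ge1}\frac{(t-1)_{n-1}\,\big((t-1)_n\big)^k\,u^n}{\prod_{i=1}^n\big(1-i(t-i)^k u\big)}.$$ In particular, for the homogenized Linial arrangements $\mathcal H_{2n-1}=\{x_i-x_j=y_i : 1\le i<j\le n+1\}$ in $\mathbb R^{2n+1}$, the Lazar–Wachs formula holds: $$\sum_{n\ge1}\chi_{\mathcal L(\mathcal H_{2n-1})}(t)\,u^n=\sum_{n\ge1}\frac{(t-1)_{n-1}\,(t-1)_n\,u^n}{\prod_{i=1}^n\big(1-i(t-i)u\big)}.$$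 -/

import Mathlib

open Polynomial
open scoped PowerSeries.WithPiTopology

noncomputable section

/-! ### Characteristic polynomials of finite ranked posets -/

/-- The rank of an element `x` of a finite ranked poset: the length of a longest chain
below `x`. -/
def elemRank {P : Type*} [PartialOrder P] (x : P) : ℕ := (Order.height x).toNat

/-- The rank (length) of a finite nonempty poset: the length of a longest chain. -/
def posetRank (P : Type*) [PartialOrder P] : ℕ := ((Order.krullDim P).unbotD 0).toNat

/-- The Möbius function of a finite poset, with integer values. -/
def moebius {P : Type*} [PartialOrder P] [Finite P] (x y : P) : ℤ :=
  letI : DecidableEq P := Classical.decEq P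
  letI : DecidableLE P := Classical.decRel _
  letI : DecidableLT P := Classical.decRel _
  letI : Fintype P := Fintype.ofFinite P
  letI : LocallyFiniteOrder P := Fintype.toLocallyFiniteOrder
  IncidenceAlgebra.mu ℤ x y

/-- The characteristic polynomial
`χ_P(t) = ∑_{x ∈ P} μ(0̂, x) t ^ (rk P - rk x)` of a finite ranked poset with bottom element. -/
def charPolynomial (P : Type*) [PartialOrder P] [OrderBot P] [Finite P] : ℤ[X] :=
  ∑ᶠ x : P, C (moebius ⊥ x) * X ^ (posetRank P - elemRank x)

/-! ### Real hyperplane arrangements and their intersection posets -/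

section Arrangements

variable {ι : Type*}

/-- A coordinate function on `ℝ^ι`, as a linear form. -/
def coord (i : ι) : (ι → ℝ) →ₗ[ℝ] ℝ := LinearMap.proj i

/-- The kernel of a linear form on `ℝ^ι`, as an affine subspace
(a linear hyperplane when the form is nonzero). -/
def hyperplane (f : (ι → ℝ) →ₗ[ℝ] ℝ) : AffineSubspace ℝ (ι → ℝ) :=
  (LinearMap.ker f).toAffineSubspace

/-- The intersection poset of a finite arrangement `A` of affine hyperplanes in `ℝ^ι`: all
nonempty intersections of subsets of `A` (the empty subset giving the whole space). -/
def IntersectionPoset (A : Finset (AffineSubspace ℝ (ι → ℝ))) : Type _ :=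
  {Y : AffineSubspace ℝ (ι → ℝ) //
    Y ≠ ⊥ ∧ ∃ S : Finset (AffineSubspace ℝ (ι → ℝ)), S ⊆ A ∧ Y = S.inf id}

/-- The intersection poset is ordered by reverse containment. -/
instance intersectionPosetPartialOrder (A : Finset (AffineSubspace ℝ (ι → ℝ))) :
    PartialOrder (IntersectionPoset A) :=
  PartialOrder.lift (fun Y => OrderDual.toDual Y.1)
    (fun _ _ h => Subtype.ext (OrderDual.toDual.injective h))

/-- The bottom element is the whole space. -/
instance intersectionPosetOrderBot (A : Finset (AffineSubspace ℝ (ι → ℝ))) :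
    OrderBot (IntersectionPoset A) where
  bot := ⟨⊤, AffineSubspace.bot_ne_top ℝ (ι → ℝ) (ι → ℝ) |>.symm, ∅, by simp, by simp⟩
  bot_le Y := show Y.1 ≤ ⊤ from le_top

instance intersectionPosetFinite (A : Finset (AffineSubspace ℝ (ι → ℝ))) :
    Finite (IntersectionPoset A) := by
  refine Finite.of_injective (β := A.powerset)
    (fun Y => ⟨Y.2.2.choose, Finset.mem_powerset.mpr Y.2.2.choose_spec.1⟩) fun Y Z h => ?_
  have h1 : Y.2.2.choose = Z.2.2.choose := congrArg Subtype.val h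
  exact Subtype.ext (Y.2.2.choose_spec.2.trans (h1 ▸ Z.2.2.choose_spec.2.symm))

end Arrangements

/-! ### Bond lattices -/

open scoped Classical in
/-- The graphic arrangement `{x_v - x_w = 0 : {v, w} ∈ E(G)}` in `ℝ^W`. -/
def graphicArrangement {W : Type*} [Fintype W] (G : SimpleGraph W) :
    Finset (AffineSubspace ℝ (W → ℝ)) :=
  (Finset.univ.filter fun p : W × W => G.Adj p.1 p.2).image
    fun p => hyperplane (coord p.1 - coord p.2)

/-- The bond lattice `Π_G` of a finite graph: the intersection lattice of its graphic
arrangement. -/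
abbrev BondLattice {W : Type*} [Fintype W] (G : SimpleGraph W) : Type _ :=
  IntersectionPoset (graphicArrangement G)

/-! ### The graphs `Γ_V` and partition types -/

/-- The graph `Γ_V` on the vertex set `V`, with an edge between an odd `a` and an even `b`
whenever `a < b`. -/
def gammaGraph (V : Finset ℕ) : SimpleGraph V where
  Adj a b := (Odd a.1 ∧ Even b.1 ∧ a.1 < b.1) ∨ (Odd b.1 ∧ Even a.1 ∧ b.1 < a.1)
  symm := ⟨fun _ _ h => h.symm⟩
  loopless := ⟨fun _ h => by rcases h with h | h <;> exact lt_irrefl _ h.2.2⟩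

/-- The partition type `λ(V)`, as the multiset of its (positive) parts: for every even element
`b` of `V`, the number of odd elements of `V` smaller than `b`. -/
def partitionType (V : Finset ℕ) : Multiset ℕ :=
  ((V.filter fun b => Even b).val.map
    fun b => (V.filter fun a => Odd a ∧ a < b).card).filter fun p => p ≠ 0

/-- The `k`-staircase with `n` steps, the partition `(nk, (n-1)k, …, k)`. -/
def kStaircase (k n : ℕ) : Multiset ℕ :=
  (Multiset.range n).map fun i => (i + 1) * k

/-! ### Ferrers graphs -/

/-- The structure of a Ferrers graph on `G`: a bipartition of the vertices into nonempty ordered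
lists `R = {r_0, …, r_a}` and `C = {c_0, …, c_b}` such that all edges join `R` to `C`; if
`{r_i, c_j}` is an edge then so is `{r_l, c_m}` for all `l ≥ i` and `m ≤ j`; and
`{r_0, c_0}`, `{r_a, c_b}` are edges. -/
structure FerrersStructure {W : Type*} (G : SimpleGraph W) where
  a : ℕ
  b : ℕ
  r : Fin (a + 1) → W
  c : Fin (b + 1) → W
  bijective : Function.Bijective (Sum.elim r c)
  not_adj_r : ∀ i j, ¬ G.Adj (r i) (r j)
  not_adj_c : ∀ i j, ¬ G.Adj (c i) (c j)
  adj_of_adj : ∀ i j l m, G.Adj (r i) (c j) → i ≤ l → m ≤ j → G.Adj (r l) (c m)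
  adj_first : G.Adj (r 0) (c 0)
  adj_last : G.Adj (r (Fin.last a)) (c (Fin.last b))

/-- The partition associated to a Ferrers graph, as the multiset of its parts: the degrees of the
vertices `r_i`. -/
def FerrersStructure.partition {W : Type*} {G : SimpleGraph W} (F : FerrersStructure G) :
    Multiset ℕ :=
  Finset.univ.val.map fun i => (G.neighborSet (F.r i)).ncard

/-! ### Chromatic polynomials -/

theorem exists_chromaticPolynomial {W : Type*} [Fintype W] (G : SimpleGraph W) :
    ∃ p : ℤ[X], ∀ q : ℕ, p.eval (q : ℤ) = Nat.card (G.Coloring (Fin q)) := by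
  classical
  let T := {s : Setoid W // ∀ v w, G.Adj v w → ¬ s v w}
  have : Finite (Setoid W) := Finite.of_injective (fun s : Setoid W => s.r)
    (fun s s' h => Setoid.ext fun v w => iff_of_eq (congrFun (congrFun h v) w))
  let _ : Fintype T := Fintype.ofFinite T
  refine ⟨∑ s : T, descPochhammer ℤ (Fintype.card (Quotient s.1)), fun q => ?_⟩
  let g : (Σ s : T, (Quotient s.1 ↪ Fin q)) → G.Coloring (Fin q) := fun x =>
    SimpleGraph.Coloring.mk (fun v => x.2 (Quotient.mk x.1.1 v))
      (fun h h' => x.1.2 _ _ h (Quotient.exact (x.2.injective h')))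
  have hg : Function.Bijective g := by
    constructor
    · rintro ⟨⟨s, hs⟩, f⟩ ⟨⟨s', hs'⟩, f'⟩ h
      have hv : ∀ v, f (Quotient.mk s v) = f' (Quotient.mk s' v) :=
        fun v => congrArg (fun c : G.Coloring (Fin q) => c v) h
      have hss : s = s' := by
        ext v w
        constructor
        · intro h1
          exact Quotient.exact (f'.injective
            ((hv v).symm.trans ((congrArg f (Quotient.sound h1)).trans (hv w))))
        · intro h1
          exact Quotient.exact (f.injective
            ((hv v).trans ((congrArg f' (Quotient.sound h1)).trans (hv w).symm)))
      subst hss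
      have hff : f = f' := by
        ext x
        induction x using Quotient.inductionOn with
        | _ v => exact congrArg Fin.val (hv v)
      rw [hff]
    · intro c
      refine ⟨⟨⟨Setoid.ker c, fun v w h h' => c.valid h h'⟩,
        ⟨Quotient.lift c (fun _ _ h => h), ?_⟩⟩, rfl⟩
      rintro ⟨v⟩ ⟨w⟩ h
      exact Quotient.sound h
  rw [← Nat.card_congr (Equiv.ofBijective g hg), Nat.card_eq_fintype_card, Fintype.card_sigma, Polynomial.eval_finsetSum]
  push_cast
  refine Finset.sum_congr rfl fun s _ => ?_
  rw [Fintype.card_embedding_eq, Fintype.card_fin, descPochhammer_eval_eq_descFactorial]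

/-- The chromatic polynomial of a finite graph: the (unique) polynomial whose value at every
natural number `q` is the number of proper colorings with `q` colors. -/
def chromaticPolynomial {W : Type*} [Fintype W] (G : SimpleGraph W) : ℤ[X] :=
  Classical.choose (exists_chromaticPolynomial G)

theorem chromaticPolynomial_eval {W : Type*} [Fintype W] (G : SimpleGraph W) (q : ℕ) :
    (chromaticPolynomial G).eval (q : ℤ) = Nat.card (G.Coloring (Fin q)) :=
  Classical.choose_spec (exists_chromaticPolynomial G) q

/-! ### Homogenized arrangements -/

/-- The coordinates of `ℝ^(m+n+1)`: `x_1, …, x_{n+1}` (left summand) and `y_i^{(l)}` for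
`1 ≤ i ≤ n`, `1 ≤ l ≤ ν_i` (right summand). -/
abbrev HomogenizedCoord {n : ℕ} (ν : Fin n → ℕ) : Type :=
  Fin (n + 1) ⊕ (Σ i : Fin n, Fin (ν i))

open scoped Classical in
/-- The homogenized `ν`-arrangement
`{x_i - x_j = y_i^{(l)} : 1 ≤ i < j ≤ n + 1, 1 ≤ l ≤ ν_i}`. -/
def homogenizedArrangement {n : ℕ} (ν : Fin n → ℕ) :
    Finset (AffineSubspace ℝ (HomogenizedCoord ν → ℝ)) :=
  (Finset.univ.filter fun p : (Σ i : Fin n, Fin (ν i)) × Fin (n + 1) =>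
      p.1.1.castSucc < p.2).image
    fun p => hyperplane
      (coord (Sum.inl p.1.1.castSucc) - coord (Sum.inl p.2)
        - coord (Sum.inr p.1))

open scoped Classical in
/-- The homogenized Linial arrangement
`{x_i - x_j = y_i : 1 ≤ i < j ≤ n + 1}` in `ℝ^(2n+1)`. -/
def homogenizedLinialArrangement (n : ℕ) :
    Finset (AffineSubspace ℝ (Fin (n + 1) ⊕ Fin n → ℝ)) :=
  (Finset.univ.filter fun p : Fin n × Fin (n + 1) => p.1.castSucc < p.2).image
    fun p => hyperplane
      (coord (Sum.inl p.1.castSucc) - coord (Sum.inl p.2)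
        - coord (Sum.inr p.1))

/-! ### Generating functions in `ℤ[t][[u]]` -/

/-- The falling factorial `(f)_n = f (f - 1) ⋯ (f - (n - 1))` of a polynomial `f`. -/
def fallingFactorial (f : ℤ[X]) (n : ℕ) : ℤ[X] := ∏ i ∈ Finset.range n, (f - (i : ℤ[X]))

/-- The denominator `∏_{i=1}^n (1 - i (t - i)^k u)`. -/
def staircaseDenominator (k n : ℕ) : PowerSeries ℤ[X] :=
  ∏ i ∈ Finset.Icc 1 n,
    (1 - PowerSeries.C ((i : ℤ[X]) * (X - (i : ℤ[X])) ^ k) * PowerSeries.X)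

theorem constantCoeff_staircaseDenominator (k n : ℕ) :
    PowerSeries.constantCoeff (staircaseDenominator k n) = 1 := by
  simp [staircaseDenominator, map_prod]

/-- The fraction `f u^n / ∏_{i=1}^n (1 - i (t - i)^k u)` in `ℤ[t][[u]]`. -/
def staircaseTerm (k : ℕ) (f : ℤ[X]) (n : ℕ) : PowerSeries ℤ[X] :=
  PowerSeries.C f * PowerSeries.X ^ n * PowerSeries.invOfUnit (staircaseDenominator k n) 1

/-- `∑_{n ≥ 1} a_n u^n = ∑_{n ≥ 1} F_n` in `ℤ[t][[u]]`, where the sum on the right converges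
in the usual topology of formal power series (coefficients are discrete). -/
def GenFunEq (a : ℕ → ℤ[X]) (F : ℕ → PowerSeries ℤ[X]) : Prop :=
  letI : TopologicalSpace ℤ[X] := ⊥
  HasSum (fun n : ℕ => F (n + 1)) (PowerSeries.mk fun n => if n = 0 then 0 else a n)

end

/-! All four families reduce to one kind of bipartite graph: rows whose nonempty neighborhoods form
a chain of sizes k, 2k, …, nk (`IsStaircase`). Color the rows first. The columns then choose
independently: a nonisolated column avoids the colors on its rows, which are a final segment of the
chain, and each final segment belongs to exactly k columns. So a row coloring f has weight ∏_j (q -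
#f({j, …, n}))^k. Adding rows from the largest to the smallest, the next row repeats one of the d
colors in use or takes one of the q - d others, so the count refined by d obeys the recursion of
`staircaseCount` (`sum_staircaseWeight`). For fixed d that recursion solves to (t)_d ((t-1)_d)^k u^d
/ ∏_{i ≤ d} (1 - i(t-i)^k u) (`mk_staircaseCount`); summing over d gives the chromatic formula.

Möbius inversion over the flats (`X_pow_mul_charPolynomial_bondLattice`) shows that the chromatic
polynomial is t^c χ, with c the number of components. A staircase graph with n ≥ 1 has exactly one
component containing edges, so the isolated vertices cancel and t χ is the same sum; dividing by t
turns (t)_d into (t-1)_{d-1}. The homogenized arrangements become graphic under the involution y_i ↦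
x_i - y_i, which turns x_i - x_j = y_i into x_j = y_i. -/

noncomputable section

/-! ### The recursion and its generating functions -/

/-- The weighted count, as a polynomial in the number of colors, of the colorings of a staircase
Ferrers graph with `n` steps that use exactly `d` colors on the rows. -/
def staircaseCount (k : ℕ) : ℕ → ℕ → ℤ[X]
  | 0, 0 => 1
  | 0, _ + 1 => 0
  | _ + 1, 0 => 0
  | n + 1, d + 1 => (X - ((d + 1 : ℕ) : ℤ[X])) ^ k *
      (((d + 1 : ℕ) : ℤ[X]) * staircaseCount k n (d + 1) +
        (X - (d : ℤ[X])) * staircaseCount k n d)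

theorem staircaseCount_eq_zero (k : ℕ) : ∀ {n d : ℕ}, n < d → staircaseCount k n d = 0
  | 0, d + 1, _ => by simp [staircaseCount]
  | n + 1, d + 1, h => by
    rw [staircaseCount, staircaseCount_eq_zero k (by omega), staircaseCount_eq_zero k (by omega)]
    simp

theorem staircaseDenominator_mul_invOfUnit (k n : ℕ) :
    staircaseDenominator k n * PowerSeries.invOfUnit (staircaseDenominator k n) 1 = 1 :=
  PowerSeries.mul_invOfUnit _ _ (by simp [constantCoeff_staircaseDenominator])

theorem eq_staircaseTerm {k : ℕ} {f : ℤ[X]} {n : ℕ} {φ : PowerSeries ℤ[X]}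
    (h : φ * staircaseDenominator k n = PowerSeries.C f * PowerSeries.X ^ n) :
    φ = staircaseTerm k f n := by
  rw [staircaseTerm, ← h, mul_assoc, staircaseDenominator_mul_invOfUnit, mul_one]

theorem staircaseDenominator_succ (k n : ℕ) :
    staircaseDenominator k (n + 1) = staircaseDenominator k n *
      (1 - PowerSeries.C (((n + 1 : ℕ) : ℤ[X]) * (X - ((n + 1 : ℕ) : ℤ[X])) ^ k) *
        PowerSeries.X) := by
  rw [staircaseDenominator, Finset.prod_Icc_succ_top (by omega)]
  rfl

theorem fallingFactorial_succ (f : ℤ[X]) (n : ℕ) :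
    fallingFactorial f (n + 1) = fallingFactorial f n * (f - (n : ℤ[X])) :=
  Finset.prod_range_succ _ _

theorem fallingFactorial_succ_left (n : ℕ) :
    fallingFactorial X (n + 1) = X * fallingFactorial (X - 1) n := by
  rw [fallingFactorial, Finset.prod_range_succ', mul_comm, fallingFactorial]
  congr 1
  · simp
  · exact Finset.prod_congr rfl fun i _ => by push_cast; ring

/-- Writing F_d for the series of column d, the recursion says F_{d+1} (1 - (d+1)(t-d-1)^k u) =
(t-d-1)^k (t-d) u F_d, and F_0 = 1. -/
theorem mk_staircaseCount (k d : ℕ) :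
    PowerSeries.mk (fun n => staircaseCount k n d) =
      staircaseTerm k (fallingFactorial X d * fallingFactorial (X - 1) d ^ k) d := by
  apply eq_staircaseTerm
  induction d with
  | zero =>
    ext1 n
    cases n <;> simp [staircaseCount, staircaseDenominator, fallingFactorial]
  | succ d ih =>
    have key : PowerSeries.mk (fun n => staircaseCount k n (d + 1)) *
        (1 - PowerSeries.C (((d + 1 : ℕ) : ℤ[X]) * (X - ((d + 1 : ℕ) : ℤ[X])) ^ k) *
          PowerSeries.X) =
        PowerSeries.C ((X - ((d + 1 : ℕ) : ℤ[X])) ^ k * (X - (d : ℤ[X]))) * PowerSeries.X *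
          PowerSeries.mk (fun n => staircaseCount k n d) := by
      ext1 n
      rw [mul_sub, mul_one, mul_left_comm, mul_assoc, map_sub, PowerSeries.coeff_C_mul,
        PowerSeries.coeff_C_mul]
      cases n with
      | zero => simp [staircaseCount]
      | succ n =>
        rw [PowerSeries.coeff_succ_mul_X, PowerSeries.coeff_succ_X_mul]
        simp only [PowerSeries.coeff_mk, staircaseCount]
        ring
    rw [staircaseDenominator_succ, mul_comm (staircaseDenominator k d), ← mul_assoc, key,
      mul_assoc, ih, fallingFactorial_succ, fallingFactorial_succ]
    -- This makes the factors (t-d-1)^k accumulate to the k-th power of a falling factorial of t-1.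
    have : (X - 1 - (d : ℤ[X])) = X - ((d + 1 : ℕ) : ℤ[X]) := by push_cast; ring
    rw [this]
    simp only [map_mul, map_pow, mul_pow]
    ring

theorem coeff_staircaseTerm (k n d : ℕ) :
    PowerSeries.coeff n
      (staircaseTerm k (fallingFactorial X d * fallingFactorial (X - 1) d ^ k) d) =
      staircaseCount k n d := by
  rw [← mk_staircaseCount, PowerSeries.coeff_mk]

/-- The extra factor t completes (t-1)_d to (t)_{d+1}; multiplying by it avoids a division. -/
theorem X_mul_coeff_staircaseTerm (k n d : ℕ) :
    X * PowerSeries.coeff n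
      (staircaseTerm k (fallingFactorial (X - 1) d * fallingFactorial (X - 1) (d + 1) ^ k)
        (d + 1)) = staircaseCount k n (d + 1) := by
  rw [← coeff_staircaseTerm, ← PowerSeries.coeff_C_mul, fallingFactorial_succ_left, staircaseTerm,
    staircaseTerm]
  simp only [map_mul, mul_assoc]

/-- Convergence is coefficientwise, and the vanishing hypothesis makes every coefficient a finite
sum. -/
theorem genFunEq_of_sum {a : ℕ → ℤ[X]} {F : ℕ → PowerSeries ℤ[X]}
    (hF : ∀ n d, n < d → PowerSeries.coeff n (F d) = 0)
    (h : ∀ n, 1 ≤ n → a n = ∑ d ∈ Finset.range n, PowerSeries.coeff n (F (d + 1))) :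
    GenFunEq a F := by
  let _ : TopologicalSpace ℤ[X] := ⊥
  have : DiscreteTopology ℤ[X] := ⟨rfl⟩
  change HasSum (fun n : ℕ => F (n + 1)) (PowerSeries.mk fun n => if n = 0 then 0 else a n)
  rw [PowerSeries.WithPiTopology.hasSum_iff_hasSum_coeff]
  intro n
  have h1 : PowerSeries.coeff n (PowerSeries.mk fun n => if n = 0 then 0 else a n) =
      ∑ d ∈ Finset.range n, PowerSeries.coeff n (F (d + 1)) := by
    rw [PowerSeries.coeff_mk]
    split_ifs with h0
    · simp [h0]
    · exact h n (by omega)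
  rw [h1]
  exact hasSum_sum_of_ne_finset_zero fun d hd => hF _ _ (by simp at hd; omega)

/-- For n ≥ 1 the summand d = 0 vanishes, so the sum matches a series that starts at 1. -/
theorem genFunEq_staircase {k : ℕ} {a : ℕ → ℤ[X]}
    (h : ∀ n, 1 ≤ n → a n = ∑ d ∈ Finset.range (n + 1), staircaseCount k n d) :
    GenFunEq a (fun n => staircaseTerm k
      (fallingFactorial X n * fallingFactorial (X - 1) n ^ k) n) := by
  refine genFunEq_of_sum (fun n d hnd => ?_) fun n hn => ?_
  · rw [coeff_staircaseTerm, staircaseCount_eq_zero k hnd]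
  · rw [h n hn, Finset.sum_range_succ']
    obtain ⟨n, rfl⟩ := Nat.exists_eq_add_of_le' hn
    simp only [coeff_staircaseTerm, staircaseCount, add_zero]

theorem genFunEq_staircase_of_X_mul {k : ℕ} {a : ℕ → ℤ[X]}
    (h : ∀ n, 1 ≤ n → X * a n = ∑ d ∈ Finset.range (n + 1), staircaseCount k n d) :
    GenFunEq a (fun n => staircaseTerm k
      (fallingFactorial (X - 1) (n - 1) * fallingFactorial (X - 1) n ^ k) n) := by
  refine genFunEq_of_sum (fun n d hnd => ?_) fun n hn => ?_
  -- The subtraction in the falling factorial is truncated, so the index is first made a successor.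
  · obtain ⟨d, rfl⟩ := Nat.exists_eq_add_of_le' (Nat.one_le_of_lt hnd)
    refine mul_left_cancel₀ (X_ne_zero (R := ℤ)) ?_
    rw [Nat.add_sub_cancel, X_mul_coeff_staircaseTerm, staircaseCount_eq_zero k hnd, mul_zero]
  · refine mul_left_cancel₀ (X_ne_zero (R := ℤ)) ?_
    rw [h n hn, Finset.sum_range_succ', Finset.mul_sum]
    obtain ⟨n, rfl⟩ := Nat.exists_eq_add_of_le' hn
    simp only [Nat.add_sub_cancel, X_mul_coeff_staircaseTerm, staircaseCount, add_zero]

/-! ### Weighted counting of row colorings -/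

/-- Summation over all functions `Fin n → Fin q`, weighted as colorings of the rows of a
staircase. -/
theorem sum_staircaseWeight (k q n : ℕ) (φ : ℕ → ℤ) :
    ∑ f : Fin n → Fin q, φ (Finset.univ.image f).card *
        ∏ j, ((q : ℤ) - ((Finset.Ici j).image f).card) ^ k =
      ∑ d ∈ Finset.range (n + 1), (staircaseCount k n d).eval (q : ℤ) * φ d := by
  induction n generalizing φ with
  | zero => simp [staircaseCount]
  | succ n ih =>
    -- The total weight of the choices for a new first row when the other rows use d colors: d
    -- choices keep the number of colors, q - d raise it. It depends on d alone, which is why the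
    -- induction runs over arbitrary φ.
    let ψ : ℕ → ℤ := fun d => d * (((q : ℤ) - d) ^ k * φ d) +
      ((q : ℤ) - d) * (((q : ℤ) - (d + 1 : ℕ)) ^ k * φ (d + 1))
    have himg : ∀ (x : Fin q) (g : Fin n → Fin q),
        Finset.univ.image (Fin.cons x g : Fin (n + 1) → Fin q) =
          insert x (Finset.univ.image g) := by
      intro x g
      ext y
      simp [Fin.exists_fin_succ, eq_comm]
    have himg' : ∀ (x : Fin q) (g : Fin n → Fin q) (j : Fin n),
        (Finset.Ici j.succ).image (Fin.cons x g : Fin (n + 1) → Fin q) =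
          (Finset.Ici j).image g := by
      intro x g j
      ext y
      simp [Fin.exists_fin_succ]
    have hzero : Finset.Ici (0 : Fin (n + 1)) = Finset.univ := by
      ext; simp
    have step : ∀ g : Fin n → Fin q, ∑ x : Fin q,
        ((q : ℤ) - (insert x (Finset.univ.image g)).card) ^ k *
          φ (insert x (Finset.univ.image g)).card = ψ (Finset.univ.image g).card := by
      intro g
      set s := Finset.univ.image g with hs
      rw [← Finset.sum_add_sum_compl s]
      rw [Finset.sum_congr rfl (g := fun _ => ((q : ℤ) - s.card) ^ k * φ s.card)
        fun x hx => by rw [Finset.insert_eq_of_mem hx]]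
      rw [Finset.sum_congr rfl (s₁ := sᶜ)
        (g := fun _ => ((q : ℤ) - (s.card + 1 : ℕ)) ^ k * φ (s.card + 1))
        fun x hx => by rw [Finset.card_insert_of_notMem (Finset.mem_compl.mp hx)]]
      rw [Finset.sum_const, Finset.sum_const, Finset.card_compl, Fintype.card_fin, nsmul_eq_mul,
        nsmul_eq_mul, Nat.cast_sub (by simpa using Finset.card_le_univ s)]
    have hψ := ih ψ
    rw [← (Fin.consEquiv fun _ => Fin q).sum_comp, Fintype.sum_prod_type, Finset.sum_comm]
    calc _ = ∑ g : Fin n → Fin q, ψ (Finset.univ.image g).card *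
          ∏ j, ((q : ℤ) - ((Finset.Ici j).image g).card) ^ k := by
          refine Finset.sum_congr rfl fun g _ => ?_
          rw [← step, Finset.sum_mul]
          refine Finset.sum_congr rfl fun x _ => ?_
          change φ (Finset.univ.image (Fin.cons x g : Fin (n + 1) → Fin q)).card *
            ∏ j, ((q : ℤ) - ((Finset.Ici j).image (Fin.cons x g : Fin (n + 1) → Fin q)).card) ^ k =
            _
          rw [Fin.prod_univ_succ, hzero]
          simp only [himg, himg']
          ring
      _ = _ := by
          rw [hψ, Finset.sum_range_succ' _ (n + 1)]
          simp only [ψ, mul_add, Finset.sum_add_distrib]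
          rw [Finset.sum_range_succ']
          -- The two halves of the recursion have ranges differing by the term d = n, which is zero:
          -- n rows cannot use n + 1 colors.
          have : ∑ d ∈ Finset.range (n + 1), (staircaseCount k n (d + 1)).eval (q : ℤ) *
              (((d + 1 : ℕ) : ℤ) * (((q : ℤ) - (d + 1 : ℕ)) ^ k * φ (d + 1))) =
              ∑ d ∈ Finset.range n, (staircaseCount k n (d + 1)).eval (q : ℤ) *
              (((d + 1 : ℕ) : ℤ) * (((q : ℤ) - (d + 1 : ℕ)) ^ k * φ (d + 1))) := by
            rw [Finset.sum_range_succ, staircaseCount_eq_zero k (Nat.lt_succ_self n)]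
            simp
          rw [← this]
          simp only [Nat.cast_zero, zero_mul, mul_zero, add_zero, staircaseCount, eval_zero]
          rw [← Finset.sum_add_distrib]
          refine Finset.sum_congr rfl fun d _ => ?_
          simp only [eval_mul, eval_add, eval_pow, eval_sub, eval_X, eval_natCast]
          ring

theorem eq_of_forall_eval_natCast {p r : ℤ[X]}
    (h : ∀ q : ℕ, p.eval (q : ℤ) = r.eval (q : ℤ)) : p = r := by
  refine eq_of_infinite_eval_eq p r
    ((Set.infinite_range_of_injective (Nat.cast_injective (R := ℤ))).mono ?_)
  rintro _ ⟨q, rfl⟩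
  exact h q

/-! ### Möbius functions and order isomorphisms -/

section Moebius

variable {P : Type*} [PartialOrder P] [Finite P]

open scoped Classical in
theorem sum_moebius_le [OrderBot P] [Fintype P] (y : P) :
    ∑ x : P, (if x ≤ y then moebius ⊥ x else 0) = if y = ⊥ then 1 else 0 := by
  let _ : LocallyFiniteOrder P := Fintype.toLocallyFiniteOrder
  have h := IncidenceAlgebra.sum_Icc_mu_right (𝕜 := ℤ) (⊥ : P) y
  rw [← Finset.sum_filter]
  have hs : Finset.univ.filter (fun x => x ≤ y) = Finset.Icc ⊥ y := by
    ext; simp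
  rw [hs]
  simp only [eq_comm (a := y)]
  convert h using 2
  -- The instances inside `moebius` are chosen classically; being subsingletons, they agree with
  -- those in scope.
  unfold moebius
  congr!

/-- The sum over a lower interval determines μ(⊥, y) from the values strictly below y. -/
theorem moebius_bot_orderIso {Q : Type*} [PartialOrder Q] [Finite Q] [OrderBot P] [OrderBot Q]
    (e : P ≃o Q) (y : P) : moebius ⊥ (e y) = moebius ⊥ y := by
  classical
  let _ := Fintype.ofFinite P
  let _ := Fintype.ofFinite Q
  induction y using WellFoundedLT.induction with
  | ind y ih =>
    have h1 := sum_moebius_le y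
    have h2 := sum_moebius_le (e y)
    rw [← e.toEquiv.sum_comp] at h2
    simp only [RelIso.coe_fn_toEquiv, map_le_map_iff, map_eq_bot_iff] at h2
    rw [← h2, ← Finset.add_sum_erase _ _ (Finset.mem_univ y),
      ← Finset.add_sum_erase _ _ (Finset.mem_univ y), Finset.sum_congr rfl
        (g := fun x => if x ≤ y then moebius ⊥ (e x) else 0)] at h1
    · simpa only [le_refl, if_true, add_left_inj] using h1.symm
    · intro x hx
      split_ifs with hxy
      · exact (ih x (lt_of_le_of_ne hxy (Finset.ne_of_mem_erase hx))).symm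
      · rfl

theorem charPolynomial_orderIso {Q : Type*} [PartialOrder Q] [Finite Q] [OrderBot P] [OrderBot Q]
    (e : P ≃o Q) : charPolynomial P = charPolynomial Q := by
  unfold charPolynomial
  rw [← finsum_comp_equiv e.toEquiv]
  refine finsum_congr fun x => ?_
  simp only [RelIso.coe_fn_toEquiv, moebius_bot_orderIso, posetRank, elemRank,
    Order.height_orderIso, Order.krullDim_eq_of_orderIso e]

end Moebius

/-! ### Flats of the bond lattice as vertex partitions -/

section Flats

theorem mem_finset_inf_affineSubspace {ι : Type*} {S : Finset (AffineSubspace ℝ (ι → ℝ))}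
    {x : ι → ℝ} : x ∈ S.inf id ↔ ∀ H ∈ S, x ∈ H := by
  classical
  induction S using Finset.induction_on with
  | empty => simp
  | insert H S _ ih => simp [AffineSubspace.mem_inf_iff, ih]

variable {W : Type*}

theorem mem_hyperplane_sub {v w : W} {x : W → ℝ} :
    x ∈ hyperplane (coord v - coord w) ↔ x v = x w := by
  simp [hyperplane, coord, sub_eq_zero]

/-- The partition of the coordinates into the classes on which all points of `Y` are constant. -/
def coordSetoid (Y : AffineSubspace ℝ (W → ℝ)) : Setoid W where
  r v w := ∀ x ∈ Y, x v = x w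
  iseqv := ⟨fun _ _ _ => rfl, fun h x hx => (h x hx).symm,
    fun h h' x hx => (h x hx).trans (h' x hx)⟩

variable [Fintype W] {G : SimpleGraph W}

theorem BondLattice.le_iff {Y Z : BondLattice G} : Y ≤ Z ↔ Z.1 ≤ Y.1 := Iff.rfl

open scoped Classical in
/-- The flat of the bond lattice cut out by the edges in a relation. -/
def bondFlat (G : SimpleGraph W) (r : W → W → Prop) : BondLattice G :=
  ⟨((Finset.univ.filter fun p : W × W => G.Adj p.1 p.2 ∧ r p.1 p.2).image
      fun p => hyperplane (coord p.1 - coord p.2)).inf id, by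
    constructor
    · intro h
      have : (0 : W → ℝ) ∈ ((Finset.univ.filter fun p : W × W => G.Adj p.1 p.2 ∧ r p.1 p.2).image
          fun p => hyperplane (coord p.1 - coord p.2)).inf id := by
        rw [mem_finset_inf_affineSubspace]
        intro H hH
        obtain ⟨p, -, rfl⟩ := Finset.mem_image.mp hH
        exact mem_hyperplane_sub.mpr rfl
      rw [h] at this
      exact this
    · exact ⟨_, Finset.image_subset_image
        (Finset.monotone_filter_right _ fun _ _ h => h.1), rfl⟩⟩

theorem mem_bondFlat {r : W → W → Prop} {x : W → ℝ} :
    x ∈ (bondFlat G r).1 ↔ ∀ v w, G.Adj v w → r v w → x v = x w := by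
  rw [bondFlat, mem_finset_inf_affineSubspace]
  simp only [Finset.mem_image, Finset.mem_filter, Finset.mem_univ, true_and, Prod.exists]
  constructor
  · intro h v w hvw hr
    exact mem_hyperplane_sub.mp (h _ ⟨v, w, ⟨hvw, hr⟩, rfl⟩)
  · rintro h _ ⟨v, w, ⟨hvw, hr⟩, rfl⟩
    exact mem_hyperplane_sub.mpr (h v w hvw hr)

/-- Every hyperplane in an intersection defining Y comes from an edge inside a class of Y, so these
edges already cut out Y. -/
theorem BondLattice.mem_iff_adj (Y : BondLattice G) {x : W → ℝ} :
    x ∈ Y.1 ↔ ∀ v w, G.Adj v w → coordSetoid Y.1 v w → x v = x w := by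
  classical
  refine ⟨fun hx v w _ h => h x hx, fun h => ?_⟩
  obtain ⟨S, hS, hY⟩ := Y.2.2
  rw [hY, mem_finset_inf_affineSubspace]
  intro H hH
  have hle : Y.1 ≤ H := hY ▸ Finset.inf_le (f := id) hH
  have hHA := hS hH
  simp only [graphicArrangement, Finset.mem_image, Finset.mem_filter, Finset.mem_univ,
    true_and] at hHA
  obtain ⟨p, hp, rfl⟩ := hHA
  exact mem_hyperplane_sub.mpr (h _ _ hp fun y hy => mem_hyperplane_sub.mp (hle hy))

theorem BondLattice.mem_iff (Y : BondLattice G) {x : W → ℝ} :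
    x ∈ Y.1 ↔ ∀ v w, coordSetoid Y.1 v w → x v = x w :=
  ⟨fun hx _ _ h => h x hx, fun h => Y.mem_iff_adj.mpr fun v w _ => h v w⟩

/-- The indicator function of a class lies in the flat. -/
theorem BondLattice.indicator_mem (Y : BondLattice G) (a : W) :
    Set.indicator {v | coordSetoid Y.1 a v} 1 ∈ Y.1 := by
  refine Y.mem_iff.mpr fun v w h => ?_
  have : coordSetoid Y.1 a v ↔ coordSetoid Y.1 a w :=
    ⟨fun h' => Setoid.trans' _ h' h, fun h' => Setoid.trans' _ h' (Setoid.symm' _ h)⟩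
  by_cases hv : coordSetoid Y.1 a v
  · rw [Set.indicator_of_mem (by exact hv), Set.indicator_of_mem (by exact this.mp hv)]; rfl
  · rw [Set.indicator_of_notMem (by exact hv), Set.indicator_of_notMem (by exact this.not.mp hv)]

theorem BondLattice.le_iff_coordSetoid {Y Z : BondLattice G} :
    Y ≤ Z ↔ coordSetoid Y.1 ≤ coordSetoid Z.1 := by
  rw [BondLattice.le_iff]
  refine ⟨fun h v w hvw x hx => hvw x (h hx), fun h x hx => ?_⟩
  exact Y.mem_iff.mpr fun v w hvw => Z.mem_iff.mp hx v w (h hvw)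

/-- Read as a real vector, the coloring lies in the flat of its monochromatic edges; testing on this
point gives the forward direction. -/
theorem BondLattice.le_bondFlat_iff (Y : BondLattice G) {q : ℕ} (f : W → Fin q) :
    Y ≤ bondFlat G (fun v w => f v = f w) ↔ ∀ v w, coordSetoid Y.1 v w → f v = f w := by
  rw [BondLattice.le_iff]
  constructor
  · intro h v w hvw
    have hx : (fun u => ((f u : ℕ) : ℝ)) ∈ (bondFlat G (fun v w => f v = f w)).1 :=
      mem_bondFlat.mpr fun v w _ h => by rw [h]
    exact Fin.ext (Nat.cast_injective (R := ℝ) (hvw _ (h hx)))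
  · intro h x hx
    exact Y.mem_iff_adj.mpr fun v w hvw hs => mem_bondFlat.mp hx v w hvw (h v w hs)

/-- The number of classes of the partition belonging to a flat. -/
def numClasses (Y : BondLattice G) : ℕ := Nat.card (Quotient (coordSetoid Y.1))

theorem numClasses_le (Y : BondLattice G) : numClasses Y ≤ Fintype.card W := by
  rw [numClasses, ← Nat.card_eq_fintype_card]
  exact Nat.card_le_card_of_surjective _ Quotient.mk_surjective

theorem numClasses_strictAnti {Y Z : BondLattice G} (h : Y < Z) :
    numClasses Z < numClasses Y := by
  have hle := BondLattice.le_iff_coordSetoid.mp h.le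
  let g : Quotient (coordSetoid Y.1) → Quotient (coordSetoid Z.1) :=
    Quotient.map' id (fun _ _ h => hle h)
  have hg : Function.Surjective g := by
    rintro ⟨v⟩
    exact ⟨Quotient.mk _ v, rfl⟩
  refine lt_of_le_of_ne (Nat.card_le_card_of_surjective g hg) fun heq => h.not_ge ?_
  have hinj : Function.Injective g :=
    (Nat.bijective_iff_surjective_and_card g |>.mpr ⟨hg, heq.symm⟩).1
  exact BondLattice.le_iff_coordSetoid.mpr fun v w hvw =>
    Quotient.exact (s := coordSetoid Y.1) (hinj (Quotient.sound hvw :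
      Quotient.mk (coordSetoid Z.1) v = Quotient.mk (coordSetoid Z.1) w))

/-- The equation x_v = x_w can only join the class of v to that of w. Once the class of v is sent to
`none`, the classes of Y inject into those of Z with one point added. -/
theorem numClasses_le_of_inf_hyperplane {Y Z : BondLattice G} {v w : W}
    (h : Z.1 = hyperplane (coord v - coord w) ⊓ Y.1) : numClasses Y ≤ numClasses Z + 1 := by
  classical
  let g : W → Option (Quotient (coordSetoid Z.1)) := fun a =>
    if coordSetoid Y.1 a v then none else some (Quotient.mk _ a)
  have hZY : ∀ a b, coordSetoid Y.1 a b → coordSetoid Z.1 a b := fun a b hab x hx =>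
    hab x (h.le hx).2
  -- The indicator of a class avoiding v and w satisfies x_v = x_w, so it lies in Z and shows that
  -- the class does not grow.
  have key : ∀ a b, ¬ coordSetoid Y.1 a v → ¬ coordSetoid Y.1 a w → coordSetoid Z.1 a b →
      coordSetoid Y.1 a b := by
    intro a b hav haw hab
    have hmem : Set.indicator {u | coordSetoid Y.1 a u} (1 : W → ℝ) ∈ Z.1 := by
      rw [h]
      refine ⟨mem_hyperplane_sub.mpr ?_, Y.indicator_mem a⟩
      rw [Set.indicator_of_notMem (by exact hav), Set.indicator_of_notMem (by exact haw)]
    have h1 := hab _ hmem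
    rw [Set.indicator_of_mem (show coordSetoid Y.1 a a from Setoid.refl' _ a)] at h1
    by_contra hb
    rw [Set.indicator_of_notMem (by exact hb)] at h1
    exact one_ne_zero h1
  have hg : ∀ a b, coordSetoid Y.1 a b → g a = g b := by
    intro a b hab
    have : coordSetoid Y.1 a v ↔ coordSetoid Y.1 b v :=
      ⟨fun h' => Setoid.trans' _ (Setoid.symm' _ hab) h', fun h' => Setoid.trans' _ hab h'⟩
    simp only [g, this]
    split_ifs
    · rfl
    · exact congrArg some (Quotient.sound (hZY _ _ hab))
  have hinj : Function.Injective (Quotient.lift g hg) := by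
    rintro ⟨a⟩ ⟨b⟩ hab
    refine Quotient.sound ?_
    change g a = g b at hab
    simp only [g] at hab
    change coordSetoid Y.1 a b
    split_ifs at hab with h1 h2 h2
    · exact Setoid.trans' _ h1 (Setoid.symm' _ h2)
    · have hab' : coordSetoid Z.1 a b := Quotient.exact (Option.some.inj hab)
      by_cases h3 : coordSetoid Y.1 a w
      · by_cases h4 : coordSetoid Y.1 b w
        · exact Setoid.trans' _ h3 (Setoid.symm' _ h4)
        · exact Setoid.symm' _ (key b a h2 h4 (Setoid.symm' _ hab'))
      · exact key a b h1 h3 hab'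
  have := Nat.card_le_card_of_injective _ hinj
  rwa [Finite.card_option] at this

theorem numClasses_bot : numClasses (⊥ : BondLattice G) = Fintype.card W := by
  classical
  rw [numClasses, ← Nat.card_eq_fintype_card]
  refine (Nat.card_congr (Equiv.ofBijective (Quotient.mk _) ⟨fun v w h => ?_,
    Quotient.mk_surjective⟩)).symm
  by_contra hne
  have := Quotient.exact h (Pi.single v 1) (AffineSubspace.mem_top ..)
  simp [Pi.single_eq_of_ne (Ne.symm hne)] at this

/-- For ≤, the number of vertices minus the number of classes is strictly increasing on flats. For
≥, intersect hyperplanes one at a time: a proper step loses at most one class and raises the height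
by at least one. -/
theorem height_add_numClasses (Y : BondLattice G) :
    Order.height Y + numClasses Y = (Fintype.card W : ℕ∞) := by
  classical
  apply le_antisymm
  · let f : BondLattice G → ℕ := fun Z => Fintype.card W - numClasses Z
    have hf : StrictMono f := fun Z Z' h => by
      have := numClasses_strictAnti h
      have := numClasses_le Z
      simp only [f]
      omega
    have h := Order.height_le_height_apply_of_strictMono f hf Y
    rw [Order.height_nat] at h
    calc Order.height Y + numClasses Y ≤ (f Y : ℕ∞) + numClasses Y := by gcongr
      _ = _ := by
        rw [← Nat.cast_add]
        have := numClasses_le Y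
        congr 1
        simp only [f]
        omega
  · have key : ∀ S ⊆ graphicArrangement G, ∀ Y : BondLattice G, Y.1 = S.inf id →
        (Fintype.card W : ℕ∞) ≤ Order.height Y + numClasses Y := by
      intro S
      induction S using Finset.induction_on with
      | empty =>
        intro _ Y hY
        have : Y = ⊥ := Subtype.ext hY
        rw [this, numClasses_bot]
        exact le_add_self
      | insert H S _ ih =>
        intro hS Y hY
        rw [Finset.inf_insert] at hY
        have hSA := (Finset.subset_insert _ _).trans hS
        let Z : BondLattice G := ⟨S.inf id, fun hbot => Y.2.1 (by rw [hY, hbot, inf_bot_eq]),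
          S, hSA, rfl⟩
        have hZ := ih hSA Z rfl
        have hZY : Z ≤ Y := BondLattice.le_iff.mpr (hY.le.trans inf_le_right)
        rcases hZY.eq_or_lt with heq | hlt
        · rwa [← heq]
        · have hHA := hS (Finset.mem_insert_self H S)
          simp only [graphicArrangement, Finset.mem_image] at hHA
          obtain ⟨p, -, rfl⟩ := hHA
          have h1 := numClasses_le_of_inf_hyperplane (Y := Z) (Z := Y) hY
          calc (Fintype.card W : ℕ∞) ≤ Order.height Z + numClasses Z := hZ
            _ ≤ Order.height Z + (numClasses Y + 1 : ℕ) := by gcongr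
            _ = (Order.height Z + 1) + numClasses Y := by push_cast; ring
            _ ≤ _ := by gcongr; exact Order.height_add_one_le hlt
    obtain ⟨S, hS, hY⟩ := Y.2.2
    exact key S hS Y hY

theorem elemRank_add_numClasses (Y : BondLattice G) :
    elemRank Y + numClasses Y = Fintype.card W := by
  have h := height_add_numClasses Y
  have hne : Order.height Y ≠ ⊤ := fun htop => by simp [htop] at h
  rw [elemRank]
  lift Order.height Y to ℕ using hne with a ha
  exact_mod_cast h

theorem le_bondFlat_top (Y : BondLattice G) : Y ≤ bondFlat G fun _ _ => True :=
  BondLattice.le_iff.mpr fun _ hx => Y.mem_iff_adj.mpr fun v w hvw _ =>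
    mem_bondFlat.mp hx v w hvw trivial

theorem numClasses_bondFlat_top :
    numClasses (bondFlat G fun _ _ => True) = Nat.card G.ConnectedComponent := by
  have : coordSetoid (bondFlat G fun _ _ => True).1 = G.reachableSetoid := by
    ext v w
    constructor
    · intro h
      have hmem : Set.indicator {u | G.Reachable v u} (1 : W → ℝ) ∈
          (bondFlat G fun _ _ => True).1 := by
        refine mem_bondFlat.mpr fun a b hab _ => ?_
        by_cases ha : G.Reachable v a
        · rw [Set.indicator_of_mem (by exact ha),
            Set.indicator_of_mem (by exact ha.trans hab.reachable)]; rfl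
        · rw [Set.indicator_of_notMem (by exact ha),
            Set.indicator_of_notMem (by exact fun hb => ha (hb.trans hab.symm.reachable))]
      have h1 := h _ hmem
      rw [Set.indicator_of_mem (by exact SimpleGraph.Reachable.refl v)] at h1
      by_contra hb
      rw [Set.indicator_of_notMem (by exact hb)] at h1
      exact one_ne_zero h1
    · rintro ⟨p⟩ x hx
      induction p with
      | nil => rfl
      | cons hadj _ ih => exact (mem_bondFlat.mp hx _ _ hadj trivial).trans ih
  rw [numClasses, this]
  rfl

theorem posetRank_add_card_connectedComponent :
    posetRank (BondLattice G) + Nat.card G.ConnectedComponent = Fintype.card W := by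
  let _ : OrderTop (BondLattice G) := { top := bondFlat G fun _ _ => True, le_top := le_bondFlat_top }
  have h := elemRank_add_numClasses (⊤ : BondLattice G)
  rw [show numClasses (⊤ : BondLattice G) = _ from numClasses_bondFlat_top] at h
  rw [← h, posetRank, ← Order.height_top_eq_krullDim, elemRank]
  rfl

theorem bondFlat_eq_bot_iff {r : W → W → Prop} :
    bondFlat G r = ⊥ ↔ ∀ v w, G.Adj v w → ¬ r v w := by
  classical
  constructor
  · intro h v w hvw hr
    have hmem : Pi.single v 1 ∈ (bondFlat G r).1 := by
      rw [h]; exact AffineSubspace.mem_top ..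
    have := mem_bondFlat.mp hmem v w hvw hr
    simp [Pi.single_eq_of_ne hvw.ne'] at this
  · intro h
    refine le_bot_iff.mp (BondLattice.le_iff.mpr fun x _ =>
      mem_bondFlat.mpr fun v w hvw hr => (h v w hvw hr).elim)

/-- The characteristic polynomial of the bond lattice agrees with the chromatic polynomial up to a
power of the variable. -/
theorem X_pow_mul_charPolynomial_bondLattice (G : SimpleGraph W) :
    X ^ Nat.card G.ConnectedComponent * charPolynomial (BondLattice G) =
      chromaticPolynomial G := by
  classical
  let _ : Fintype (BondLattice G) := Fintype.ofFinite _
  refine eq_of_forall_eval_natCast fun q => ?_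
  rw [chromaticPolynomial_eval, charPolynomial, finsum_eq_sum_of_fintype, Finset.mul_sum,
    eval_finsetSum]
  -- The power of q counts the maps to q colors that are constant on the classes of Y, that is,
  -- those whose flat of monochromatic edges lies above Y.
  have h1 : ∀ Y : BondLattice G,
      (X ^ Nat.card G.ConnectedComponent *
        (C (moebius ⊥ Y) * X ^ (posetRank (BondLattice G) - elemRank Y))).eval (q : ℤ) =
      ∑ f : W → Fin q,
        if Y ≤ bondFlat G (fun v w => f v = f w) then moebius ⊥ Y else 0 := by
    intro Y
    have hr := posetRank_add_card_connectedComponent (G := G)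
    have hY := elemRank_add_numClasses Y
    have hle : Nat.card G.ConnectedComponent ≤ numClasses Y := by
      rw [← numClasses_bondFlat_top]
      rcases (le_bondFlat_top Y).eq_or_lt with h | h
      · exact (congrArg numClasses h).ge
      · exact (numClasses_strictAnti h).le
    have hexp : Nat.card G.ConnectedComponent + (posetRank (BondLattice G) - elemRank Y) =
        numClasses Y := by omega
    have hcard : (Finset.univ.filter fun f : W → Fin q =>
        Y ≤ bondFlat G (fun v w => f v = f w)).card = q ^ numClasses Y := by
      rw [← Fintype.card_subtype, ← Nat.card_eq_fintype_card, numClasses]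
      have e : {f : W → Fin q // Y ≤ bondFlat G (fun v w => f v = f w)} ≃
          (Quotient (coordSetoid Y.1) → Fin q) :=
        { toFun := fun f => Quotient.lift f.1 ((Y.le_bondFlat_iff f.1).mp f.2)
          invFun := fun g => ⟨fun v => g (Quotient.mk _ v),
            (Y.le_bondFlat_iff _).mpr fun v w h => congrArg g (Quotient.sound h)⟩
          left_inv := fun f => rfl
          right_inv := fun g => by
            funext x
            induction x using Quotient.inductionOn
            rfl }
      rw [Nat.card_congr e, Nat.card_fun, Nat.card_fin]
    rw [mul_left_comm, ← pow_add, hexp, ← Finset.sum_filter, Finset.sum_const, hcard]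
    simp [mul_comm]
  -- After the exchange of sums, the inner Möbius sum is 1 if f has no monochromatic edge and 0
  -- otherwise.
  rw [Finset.sum_congr rfl fun Y _ => h1 Y, Finset.sum_comm]
  simp only [sum_moebius_le, bondFlat_eq_bot_iff]
  rw [Finset.sum_boole, ← Fintype.card_subtype, ← Nat.card_eq_fintype_card]
  congr 1
  exact Nat.card_congr
    { toFun := fun f => SimpleGraph.Coloring.mk f.1 fun {v w} h => f.2 v w h
      invFun := fun c => ⟨c, fun v w h => c.valid h⟩
      left_inv := fun _ => rfl
      right_inv := fun _ => rfl }

end Flats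

/-! ### Colorings and components of staircase bipartite graphs -/

section Bipartite

variable {R C : Type*}

/-- The bipartite graph in which a row `r` is joined to the columns in `A r`. -/
def bipartiteGraph (A : R → Finset C) : SimpleGraph (R ⊕ C) where
  Adj
    | .inl r, .inr c => c ∈ A r
    | .inr c, .inl r => c ∈ A r
    | _, _ => False
  symm := ⟨by rintro (r | c) (r' | c') h <;> exact h⟩
  loopless := ⟨by rintro (r | c) h <;> exact h⟩

/-- The neighborhoods of the rows are empty, except for a chain of neighborhoods of sizes
`k, 2k, …, nk`. -/
def IsStaircase (k n : ℕ) (A : R → Finset C) : Prop :=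
  ∃ e : Fin n → R, Function.Injective e ∧ Monotone (A ∘ e) ∧
    (∀ i, (A (e i)).card = (i + 1) * k) ∧ ∀ r, r ∉ Set.range e → A r = ∅

theorem kStaircase_filter {k : ℕ} (hk : 1 ≤ k) (n : ℕ) :
    (kStaircase k n).filter (fun p => p ≠ 0) = kStaircase k n := by
  refine Multiset.filter_eq_self.mpr fun p hp => ?_
  obtain ⟨i, -, rfl⟩ := Multiset.mem_map.mp hp
  positivity

theorem kStaircase_nodup {k : ℕ} (hk : 1 ≤ k) (n : ℕ) : (kStaircase k n).Nodup := by
  refine Multiset.Nodup.map (fun i j h => ?_) (Multiset.nodup_range n)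
  have := Nat.eq_of_mul_eq_mul_right hk h
  omega

/-- Since k ≥ 1 the parts are positive and distinct, so each comes from exactly one row;
comparability turns the order by size into inclusion. -/
theorem isStaircase_of_chain [Fintype R] {k n : ℕ} (hk : 1 ≤ k) {A : R → Finset C}
    (hA : ∀ r s, A r ⊆ A s ∨ A s ⊆ A r)
    (h : ((Finset.univ.val.map fun r => (A r).card).filter fun p => p ≠ 0) = kStaircase k n) :
    IsStaircase k n A := by
  have hex : ∀ i : Fin n, ∃ r, (A r).card = (i + 1) * k := fun i => by
    have : (i + 1) * k ∈ kStaircase k n :=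
      Multiset.mem_map.mpr ⟨i, Multiset.mem_range.mpr i.2, rfl⟩
    rw [← h, Multiset.mem_filter, Multiset.mem_map] at this
    obtain ⟨⟨r, -, hr⟩, -⟩ := this
    exact ⟨r, hr⟩
  choose e he using hex
  refine ⟨e, fun i j hij => ?_, fun i j hij => ?_, he, fun r hr => ?_⟩
  · have h1 := he i
    rw [hij, he j] at h1
    have := Nat.eq_of_mul_eq_mul_right hk h1
    exact Fin.ext (by omega)
  · rcases hA (e i) (e j) with h1 | h1
    · exact h1
    · refine (Finset.eq_of_subset_of_card_le h1 ?_).ge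
      rw [he, he]
      have : (i : ℕ) ≤ j := hij
      gcongr
  · by_contra hne
    have hcard : (A r).card ≠ 0 := fun h0 => hne (Finset.card_eq_zero.mp h0)
    have hmem : (A r).card ∈ kStaircase k n := by
      rw [← h, Multiset.mem_filter]
      exact ⟨Multiset.mem_map_of_mem _ (Finset.mem_val.mpr (Finset.mem_univ r)), hcard⟩
    obtain ⟨i, hi, hir⟩ := Multiset.mem_map.mp hmem
    have hnd := kStaircase_nodup hk n
    rw [← h, Multiset.filter_map] at hnd
    have hi' := he ⟨i, Multiset.mem_range.mp hi⟩
    refine hr ⟨⟨i, Multiset.mem_range.mp hi⟩, ?_⟩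
    refine Multiset.inj_on_of_nodup_map hnd _ ?_ _ ?_ (hi'.trans hir)
    · rw [Multiset.mem_filter]
      exact ⟨Finset.mem_univ _, by simp only [Function.comp_apply]; rw [hi'.trans hir]; exact hcard⟩
    · rw [Multiset.mem_filter]
      exact ⟨Finset.mem_univ _, hcard⟩

open scoped Classical in
-- Once the rows are colored, the columns choose independently among the colors missing from their
-- neighbors.
theorem card_coloring_bipartiteGraph [Fintype R] [Fintype C] (A : R → Finset C) (q : ℕ) :
    (Nat.card ((bipartiteGraph A).Coloring (Fin q)) : ℤ) =
      ∑ f : R → Fin q, ∏ c : C,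
        ((q : ℤ) - ((Finset.univ.filter fun r => c ∈ A r).image f).card) := by
  let E : (bipartiteGraph A).Coloring (Fin q) ≃
      Σ f : R → Fin q, ∀ c : C, {x : Fin q // x ∉ (Finset.univ.filter fun r => c ∈ A r).image f} :=
    { toFun := fun g => ⟨fun r => g (.inl r), fun c => ⟨g (.inr c), by
        intro hx
        obtain ⟨r, hr, hg⟩ := Finset.mem_image.mp hx
        exact g.valid (v := .inl r) (w := .inr c) (Finset.mem_filter.mp hr).2 hg⟩⟩
      invFun := fun p => SimpleGraph.Coloring.mk
        (fun v => Sum.elim p.1 (fun c => (p.2 c).1) v) (by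
          have key : ∀ r c, c ∈ A r → p.1 r ≠ (p.2 c).1 := fun r c h heq =>
            (p.2 c).2 (Finset.mem_image.mpr
              ⟨r, Finset.mem_filter.mpr ⟨Finset.mem_univ _, h⟩, heq⟩)
          rintro (r | c) (r' | c') h
          · exact h.elim
          · exact key _ _ h
          · exact (key _ _ h).symm
          · exact h.elim)
      left_inv := fun g => by
        apply RelHom.ext
        rintro (r | c) <;> rfl
      right_inv := fun p => rfl }
  rw [Nat.card_congr E, Nat.card_eq_fintype_card, Fintype.card_sigma, Nat.cast_sum]
  refine Finset.sum_congr rfl fun f _ => ?_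
  rw [Fintype.card_pi, Nat.cast_prod]
  refine Finset.prod_congr rfl fun c _ => ?_
  rw [Fintype.card_subtype_compl, Fintype.card_fin, Fintype.card_coe, Nat.cast_sub]
  simpa using Finset.card_le_univ ((Finset.univ.filter fun r => c ∈ A r).image f)

open scoped Classical in
/-- The product over the columns, for rows forming a staircase. -/
theorem prod_columns [Fintype C] {k n : ℕ} {B : Fin n → Finset C} (hB : Monotone B)
    (hcard : ∀ i, (B i).card = (i + 1) * k) (q : ℕ) (g : Fin n → Fin q) :
    ∏ c : C, ((q : ℤ) - ((Finset.univ.filter fun i => c ∈ B i).image g).card) =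
      (q : ℤ) ^ Nat.card {c // ∀ i, c ∉ B i} *
        ∏ j, ((q : ℤ) - ((Finset.Ici j).image g).card) ^ k := by
  -- The option records the first row containing c; by monotonicity the rows containing c are
  -- exactly those from there on.
  have hex : ∀ c, ∃ o : Option (Fin n), (o = none ∧ ∀ i, c ∉ B i) ∨
      ∃ j, o = some j ∧ ∀ i, c ∈ B i ↔ j ≤ i := by
    intro c
    by_cases h : ∃ i, c ∈ B i
    · have hne : (Finset.univ.filter fun i => c ∈ B i).Nonempty := by
        obtain ⟨i, hi⟩ := h
        exact ⟨i, by simpa using hi⟩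
      refine ⟨some (Finset.min' _ hne), Or.inr ⟨_, rfl, fun i => ⟨fun hi => ?_, fun hi => ?_⟩⟩⟩
      · exact Finset.min'_le _ _ (by simpa using hi)
      · exact hB hi (Finset.mem_filter.mp (Finset.min'_mem _ hne)).2
    · exact ⟨none, Or.inl ⟨rfl, fun i hi => h ⟨i, hi⟩⟩⟩
  choose o ho using hex
  have hnone : ∀ c, o c = none ↔ ∀ i, c ∉ B i := by
    intro c
    rcases ho c with ⟨h1, h2⟩ | ⟨j, h1, h2⟩
    · simp [h1, h2]
    · simp [h1, h2]
      exact ⟨j, le_rfl⟩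
  have hsome : ∀ c j, o c = some j ↔ ∀ i, c ∈ B i ↔ j ≤ i := by
    intro c j
    rcases ho c with ⟨h1, h2⟩ | ⟨j', h1, h2⟩
    · simp only [h1, h2, reduceCtorEq, false_iff]
      exact fun h => h j le_rfl
    · simp only [h1, h2, Option.some.injEq]
      exact ⟨fun h i => by rw [h], fun h => le_antisymm ((h j).mpr le_rfl) ((h j').mp le_rfl)⟩
  rw [← Fintype.prod_fiberwise o, Fintype.prod_option]
  congr 1
  · have : ∀ c : {c // o c = none},
        ((q : ℤ) - ((Finset.univ.filter fun i => c.1 ∈ B i).image g).card) = q := by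
      intro c
      rw [Finset.filter_false_of_mem fun i _ => (hnone c).mp c.2 i]
      simp
    rw [Finset.prod_congr rfl fun c _ => this c, Finset.prod_const, Finset.card_univ,
      ← Nat.card_eq_fintype_card]
    congr 1
    exact Nat.card_congr (Equiv.subtypeEquivRight hnone)
  · refine Finset.prod_congr rfl fun j _ => ?_
    have : ∀ c : {c // o c = some j},
        ((q : ℤ) - ((Finset.univ.filter fun i => c.1 ∈ B i).image g).card) =
          (q : ℤ) - ((Finset.Ici j).image g).card := by
      intro c
      congr 4
      ext i
      simp [(hsome c.1 j).mp c.2 i]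
    rw [Finset.prod_congr rfl fun c _ => this c, Finset.prod_const, Finset.card_univ]
    congr 1
    rw [Fintype.card_subtype]
    -- The columns with first row j form B_j \ B_{j-1}, of size k. For j = 0 there is no
    -- predecessor, and B_0 itself has size k.
    by_cases hj : (j : ℕ) = 0
    · have : Finset.univ.filter (fun c => o c = some j) = B j := by
        ext c
        simp only [Finset.mem_filter, Finset.mem_univ, true_and, hsome]
        refine ⟨fun h => (h j).mpr le_rfl, fun h i => ?_⟩
        have hji : j ≤ i := Fin.le_def.mpr (by omega)
        exact ⟨fun _ => hji, fun _ => hB hji h⟩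
      rw [this, hcard, hj]
      simp
    · let j' : Fin n := ⟨j - 1, by omega⟩
      have hj' : j' ≤ j := Fin.le_def.mpr (Nat.sub_le _ _)
      have : Finset.univ.filter (fun c => o c = some j) = B j \ B j' := by
        ext c
        simp only [Finset.mem_filter, Finset.mem_univ, true_and, hsome, Finset.mem_sdiff]
        refine ⟨fun h => ⟨(h j).mpr le_rfl, fun h' => ?_⟩, fun h i => ⟨fun hi => ?_, fun hi => ?_⟩⟩
        · have : (j : ℕ) ≤ j - 1 := (h j').mp h'
          omega
        · by_contra hlt
          refine h.2 (hB (Fin.le_def.mpr ?_) hi)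
          have : (i : ℕ) < j := Fin.lt_def.mp (not_le.mp hlt)
          change (i : ℕ) ≤ j - 1
          omega
        · exact hB hi h.1
      rw [this, Finset.card_sdiff_of_subset (hB hj'), hcard, hcard, ← Nat.sub_mul]
      have : (j : ℕ) + 1 - ((j' : ℕ) + 1) = 1 := by
        change (j : ℕ) + 1 - (j - 1 + 1) = 1
        omega
      rw [this, one_mul]

/-- Isolated rows and columns are colored freely, giving the power of X; the rest is the weighted
sum over the chain with φ = 1. -/
theorem chromaticPolynomial_bipartiteGraph [Fintype R] [Fintype C] {k n : ℕ} (hk : 1 ≤ k)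
    {A : R → Finset C} (hA : IsStaircase k n A) :
    chromaticPolynomial (bipartiteGraph A) =
      X ^ Nat.card {v // ∀ w, ¬ (bipartiteGraph A).Adj v w} *
        ∑ d ∈ Finset.range (n + 1), staircaseCount k n d := by
  classical
  obtain ⟨e, he, hmono, hcard, hempty⟩ := hA
  have hiso : Nat.card {v // ∀ w, ¬ (bipartiteGraph A).Adj v w} =
      Nat.card {r // r ∉ Set.range e} + Nat.card {c // ∀ i, c ∉ A (e i)} := by
    rw [Nat.card_congr Equiv.subtypeSum, Nat.card_sum]
    congr 1
    · refine Nat.card_congr (Equiv.subtypeEquivRight fun r => ⟨?_, ?_⟩)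
      · rintro h ⟨i, rfl⟩
        have : 0 < (A (e i)).card := by rw [hcard]; positivity
        obtain ⟨c, hc⟩ := Finset.card_pos.mp this
        exact h (.inr c) hc
      · rintro h (r' | c) hadj
        · exact hadj
        · have : c ∈ A r := hadj
          rw [hempty r h] at this
          simp at this
    · refine Nat.card_congr (Equiv.subtypeEquivRight fun c => ⟨fun h i hi => h (.inl (e i)) hi, ?_⟩)
      rintro h (r | c') hadj
      · have hc : c ∈ A r := hadj
        by_cases hr : r ∈ Set.range e
        · obtain ⟨i, rfl⟩ := hr
          exact h i hc
        · rw [hempty r hr] at hc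
          simp at hc
      · exact hadj
  refine eq_of_forall_eval_natCast fun q => ?_
  rw [chromaticPolynomial_eval, card_coloring_bipartiteGraph, hiso, eval_mul, eval_finsetSum,
    eval_pow, eval_X]
  let E : Fin n ⊕ {r // r ∉ Set.range e} ≃ R :=
    (Equiv.sumCongr (Equiv.ofInjective e he) (Equiv.refl _)).trans (Equiv.Set.sumCompl _)
  have hE : ∀ i, E (.inl i) = e i := fun i => rfl
  let F : (Fin n → Fin q) × ({r // r ∉ Set.range e} → Fin q) ≃ (R → Fin q) :=
    (Equiv.sumArrowEquivProdArrow _ _ _).symm.trans (E.arrowCongr (Equiv.refl _))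
  have hF : ∀ p i, F p (e i) = p.1 i := by
    intro p i
    rw [← hE]
    simp [F]
    rfl
  have himage : ∀ p c, (Finset.univ.filter fun r => c ∈ A r).image (F p) =
      (Finset.univ.filter fun i => c ∈ (A ∘ e) i).image p.1 := by
    intro p c
    ext x
    simp only [Finset.mem_image, Finset.mem_filter, Finset.mem_univ, true_and,
      Function.comp_apply]
    constructor
    · rintro ⟨r, hr, rfl⟩
      by_cases hre : r ∈ Set.range e
      · obtain ⟨i, rfl⟩ := hre
        exact ⟨i, hr, (hF p i).symm⟩
      · rw [hempty r hre] at hr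
        simp at hr
    · rintro ⟨i, hi, rfl⟩
      exact ⟨e i, hi, hF p i⟩
  rw [← F.sum_comp, Fintype.sum_prod_type]
  simp only [himage, prod_columns hmono hcard, Finset.sum_const, Finset.card_univ,
    Fintype.card_fun, Fintype.card_fin, nsmul_eq_mul]
  rw [← Finset.mul_sum, ← Finset.mul_sum]
  have hsum := sum_staircaseWeight k q n (fun _ => 1)
  simp only [one_mul, mul_one] at hsum
  rw [hsum, pow_add, Nat.card_eq_fintype_card (α := {r // r ∉ Set.range e})]
  push_cast
  simp only [Function.comp_apply]
  ring

/-- If all vertices that are not isolated lie in one component, then the other components are the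
isolated vertices. -/
theorem card_connectedComponent_of_reachable {W : Type*} [Finite W] {G : SimpleGraph W} {u u' : W}
    (hu : G.Adj u u') (h : ∀ v w, G.Adj v w → G.Reachable u v) :
    Nat.card G.ConnectedComponent = Nat.card {v // ∀ w, ¬ G.Adj v w} + 1 := by
  classical
  rw [← Finite.card_option]
  symm
  let g : Option {v // ∀ w, ¬ G.Adj v w} → G.ConnectedComponent := fun o =>
    o.elim (G.connectedComponentMk u) fun v => G.connectedComponentMk v.1
  have hiso : ∀ v w, (∀ x, ¬ G.Adj v x) → G.Reachable v w → v = w := by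
    rintro v w hv ⟨p⟩
    cases p with
    | nil => rfl
    | cons hadj _ => exact (hv _ hadj).elim
  refine Nat.card_congr (Equiv.ofBijective g ⟨?_, ?_⟩)
  · rintro (_ | v) (_ | w) hvw
    · rfl
    · have := hiso w.1 u w.2 (SimpleGraph.ConnectedComponent.exact hvw).symm
      exact (w.2 u' (this ▸ hu)).elim
    · have := hiso v.1 u v.2 (SimpleGraph.ConnectedComponent.exact hvw)
      exact (v.2 u' (this ▸ hu)).elim
    · exact congrArg some (Subtype.ext (hiso _ _ v.2 (SimpleGraph.ConnectedComponent.exact hvw)))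
  · intro x
    induction x using SimpleGraph.ConnectedComponent.ind with
    | _ v =>
      by_cases hv : ∀ w, ¬ G.Adj v w
      · exact ⟨some ⟨v, hv⟩, rfl⟩
      · push Not at hv
        obtain ⟨w, hw⟩ := hv
        exact ⟨none, SimpleGraph.ConnectedComponent.sound (h v w hw)⟩

/-- The largest row is adjacent to every nonisolated column, and through these it reaches every
nonempty row. -/
theorem card_connectedComponent_bipartiteGraph [Finite R] [Finite C] {k n : ℕ} (hk : 1 ≤ k)
    (hn : 1 ≤ n) {A : R → Finset C} (hA : IsStaircase k n A) :
    Nat.card (bipartiteGraph A).ConnectedComponent =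
      Nat.card {v // ∀ w, ¬ (bipartiteGraph A).Adj v w} + 1 := by
  obtain ⟨e, -, hmono, hcard, hempty⟩ := hA
  let l : Fin n := ⟨n - 1, by omega⟩
  have hl : ∀ i, i ≤ l := fun i => Fin.le_def.mpr (by change (i : ℕ) ≤ n - 1; omega)
  have hne : ∀ i, ∃ c, c ∈ A (e i) := fun i =>
    Finset.card_pos.mp (by rw [hcard]; positivity)
  have hrow : ∀ r c, c ∈ A r → c ∈ A (e l) := by
    intro r c hc
    by_cases hr : r ∈ Set.range e
    · obtain ⟨i, rfl⟩ := hr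
      exact hmono (hl i) hc
    · rw [hempty r hr] at hc
      simp at hc
  have hcol : ∀ r c, c ∈ A r → (bipartiteGraph A).Reachable (.inl (e l)) (.inr c) :=
    fun r c hc => SimpleGraph.Adj.reachable (hrow r c hc)
  obtain ⟨c₀, hc₀⟩ := hne l
  refine card_connectedComponent_of_reachable (u := .inl (e l)) (u' := .inr c₀) hc₀ ?_
  rintro (r | c) (r' | c') h
  · exact h.elim
  · have hadj : (bipartiteGraph A).Adj (.inr c') (.inl r) := h
    exact (hcol r c' h).trans hadj.reachable
  · exact hcol r' c h
  · exact h.elim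

variable {W : Type*} [Fintype W] {G : SimpleGraph W}

theorem chromaticPolynomial_iso {W' : Type*} [Fintype W'] {G' : SimpleGraph W'} (φ : G ≃g G') :
    chromaticPolynomial G = chromaticPolynomial G' := by
  refine eq_of_forall_eval_natCast fun q => ?_
  rw [chromaticPolynomial_eval, chromaticPolynomial_eval]
  congr 1
  exact Nat.card_congr
    { toFun := fun c => c.comp φ.symm.toHom
      invFun := fun c => c.comp φ.toHom
      left_inv := fun c => by apply RelHom.ext; intro v; exact congrArg c (φ.symm_apply_apply v)
      right_inv := fun c => by
        apply RelHom.ext; intro v; exact congrArg c (φ.apply_symm_apply v) }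

/-- The isolated vertices contribute the same power of X to both sides; the one other component
leaves a single factor X. -/
theorem X_mul_charPolynomial_of_iso [Fintype R] [Fintype C] {k n : ℕ} (hk : 1 ≤ k)
    (hn : 1 ≤ n) {A : R → Finset C} (hA : IsStaircase k n A) (φ : G ≃g bipartiteGraph A) :
    X * charPolynomial (BondLattice G) = ∑ d ∈ Finset.range (n + 1), staircaseCount k n d := by
  have h := X_pow_mul_charPolynomial_bondLattice G
  rw [chromaticPolynomial_iso φ, chromaticPolynomial_bipartiteGraph hk hA,
    Nat.card_congr φ.connectedComponentEquiv, card_connectedComponent_bipartiteGraph hk hn hA,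
    pow_succ, mul_assoc] at h
  exact mul_left_cancel₀ (pow_ne_zero _ X_ne_zero) h

end Bipartite

/-! ### Intersection posets under linear changes of coordinates -/

section LinearChange

variable {ι κ : Type*}

theorem finset_inf_comap [DecidableEq (AffineSubspace ℝ (ι → ℝ))]
    (φ : (ι → ℝ) ≃ₗ[ℝ] (κ → ℝ)) (S : Finset (AffineSubspace ℝ (κ → ℝ))) :
    (S.image fun H => H.comap φ.toLinearMap.toAffineMap).inf id =
      (S.inf id).comap φ.toLinearMap.toAffineMap := by
  ext x
  simp only [AffineSubspace.mem_comap, mem_finset_inf_affineSubspace, Finset.forall_mem_image]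

theorem comap_le_comap_iff (φ : (ι → ℝ) ≃ₗ[ℝ] (κ → ℝ)) {Y Z : AffineSubspace ℝ (κ → ℝ)} :
    Y.comap φ.toLinearMap.toAffineMap ≤ Z.comap φ.toLinearMap.toAffineMap ↔ Y ≤ Z := by
  refine ⟨fun h x hx => ?_, fun h => AffineSubspace.comap_mono h⟩
  have := @h (φ.symm x) (by simpa [AffineSubspace.mem_comap] using hx)
  simpa [AffineSubspace.mem_comap] using this

/-- A linear change of coordinates induces an isomorphism of intersection posets. -/
theorem nonempty_orderIso_of_image_comap [DecidableEq (AffineSubspace ℝ (ι → ℝ))]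
    (φ : (ι → ℝ) ≃ₗ[ℝ] (κ → ℝ)) {A : Finset (AffineSubspace ℝ (κ → ℝ))}
    {B : Finset (AffineSubspace ℝ (ι → ℝ))}
    (h : B = A.image fun H => H.comap φ.toLinearMap.toAffineMap) :
    Nonempty (IntersectionPoset A ≃o IntersectionPoset B) := by
  classical
  have hbot : (⊥ : AffineSubspace ℝ (κ → ℝ)).comap φ.toLinearMap.toAffineMap = ⊥ := by
    ext x
    simp
  have hinj : Function.Injective fun Y : AffineSubspace ℝ (κ → ℝ) =>
      Y.comap φ.toLinearMap.toAffineMap := fun Y Z hYZ =>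
    le_antisymm ((comap_le_comap_iff φ).mp hYZ.le) ((comap_le_comap_iff φ).mp hYZ.ge)
  let g : IntersectionPoset A → IntersectionPoset B := fun Y =>
    ⟨Y.1.comap φ.toLinearMap.toAffineMap, fun hY => Y.2.1 (hinj (hY.trans hbot.symm)), by
      obtain ⟨S, hS, hY⟩ := Y.2.2
      exact ⟨S.image fun H => H.comap φ.toLinearMap.toAffineMap,
        h ▸ Finset.image_subset_image hS, by rw [finset_inf_comap, hY]⟩⟩
  have hg : Function.Bijective g := by
    refine ⟨fun Y Z hYZ => Subtype.ext (hinj (congrArg Subtype.val hYZ)), fun Z => ?_⟩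
    obtain ⟨T, hT, hZ⟩ := Z.2.2
    rw [h] at hT
    obtain ⟨S, hS, rfl⟩ := Finset.subset_image_iff.mp hT
    rw [finset_inf_comap] at hZ
    refine ⟨⟨S.inf id, fun hb => Z.2.1 (by rw [hZ, hb, hbot]), S, hS, rfl⟩,
      Subtype.ext hZ.symm⟩
  exact ⟨{ Equiv.ofBijective g hg with
    map_rel_iff' := fun {Y Z} => comap_le_comap_iff (Y := Z.1) (Z := Y.1) φ }⟩

end LinearChange

/-! ### Homogenized arrangements as graphic arrangements -/

section Homogenized

variable {n : ℕ} {D : Type*} [Fintype D]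

/-- The row of `x_j` is joined to the columns belonging to the coordinates `y_i` with `i < j`,
where `p` gives the index `i`. -/
def homogenizedRow (p : D → Fin n) (j : Fin (n + 1)) : Finset D :=
  Finset.univ.filter fun d => (p d).castSucc < j

/-- Counting from 0, row j has the jk columns of index below j: row 0 is empty and the others form
the chain. -/
theorem isStaircase_homogenizedRow {k : ℕ} (p : D → Fin n)
    (hp : ∀ i, (Finset.univ.filter fun d => p d = i).card = k) :
    IsStaircase k n (homogenizedRow p) := by
  refine ⟨Fin.succ, Fin.succ_injective n, fun i j hij d hd => ?_, fun i => ?_, fun r hr => ?_⟩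
  · simp only [Function.comp_apply, homogenizedRow, Finset.mem_filter, Finset.mem_univ,
      true_and] at hd ⊢
    exact hd.trans_le (Fin.succ_le_succ_iff.mpr hij)
  · have : homogenizedRow p i.succ = Finset.univ.filter fun d => p d ∈ Finset.Iic i := by
      ext d
      simp [homogenizedRow, Fin.castSucc_lt_succ_iff]
    rw [this, Finset.card_eq_sum_card_fiberwise (f := p) (t := Finset.Iic i)
      fun d hd => by simpa using hd]
    rw [Finset.sum_congr rfl (g := fun _ => k)]
    · simp
    · intro j hj
      rw [← hp j, Finset.filter_filter]
      congr 1
      ext d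
      simp only [Finset.mem_filter, Finset.mem_univ, true_and]
      exact ⟨fun h => h.2, fun h => ⟨h ▸ hj, h⟩⟩
  · have : r = 0 := by
      by_contra h0
      exact hr ⟨r.pred h0, Fin.succ_pred r h0⟩
    subst this
    simp [homogenizedRow]

/-- The change of coordinates that replaces `y_i` by `x_i - y_i`. -/
def homogenizedChange (p : D → Fin n) :
    (Fin (n + 1) ⊕ D → ℝ) ≃ₗ[ℝ] (Fin (n + 1) ⊕ D → ℝ) :=
  LinearEquiv.ofInvolutive
    { toFun := fun x => Sum.elim (fun j => x (.inl j))
        fun d => x (.inl (p d).castSucc) - x (.inr d)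
      map_add' := fun x y => by
        ext (j | d)
        · simp
        · simp; ring
      map_smul' := fun c x => by
        ext (j | d)
        · simp
        · simp; ring }
    fun x => by ext (j | d) <;> simp

open scoped Classical in
-- In the new coordinates x_i - x_j = y_d, with i the index of d, reads x_j = y_d, an edge equation.
theorem nonempty_orderIso_bondLattice (p : D → Fin n) :
    Nonempty (BondLattice (bipartiteGraph (homogenizedRow p)) ≃o
      IntersectionPoset ((Finset.univ.filter fun z : D × Fin (n + 1) =>
        (p z.1).castSucc < z.2).image fun z => hyperplane
          (coord (Sum.inl (p z.1).castSucc) - coord (Sum.inl z.2) - coord (Sum.inr z.1)))) := by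
  refine nonempty_orderIso_of_image_comap (homogenizedChange p) ?_
  have hcomap : ∀ d j, (hyperplane (coord (.inl j) - coord (.inr d))).comap
      (homogenizedChange p).toLinearMap.toAffineMap =
        hyperplane (coord (.inl (p d).castSucc) - coord (.inl j) - coord (.inr d)) := by
    intro d j
    ext x
    change x (.inl j) - (x (.inl (p d).castSucc) - x (.inr d)) = 0 ↔
      x (.inl (p d).castSucc) - x (.inl j) - x (.inr d) = 0
    constructor <;> intro h <;> linarith
  have hsymm : ∀ v w : Fin (n + 1) ⊕ D, hyperplane (coord v - coord w) =
      hyperplane (coord w - coord v) := by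
    intro v w
    ext x
    rw [mem_hyperplane_sub, mem_hyperplane_sub, eq_comm]
  have hadj : ∀ d j, (bipartiteGraph (homogenizedRow p)).Adj (.inl j) (.inr d) ↔
      (p d).castSucc < j := by
    intro d j
    simp [bipartiteGraph, homogenizedRow]
  ext H
  simp only [graphicArrangement, Finset.image_image, Finset.mem_image, Finset.mem_filter,
    Finset.mem_univ, true_and, Prod.exists, Function.comp_apply]
  constructor
  · rintro ⟨d, j, h, rfl⟩
    exact ⟨.inl j, .inr d, (hadj d j).mpr h, hcomap d j⟩
  · rintro ⟨v | d, w | d', h, rfl⟩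
    · exact h.elim
    · exact ⟨d', v, (hadj d' v).mp h, (hcomap d' v).symm⟩
    -- The graphic arrangement lists each edge in both orientations; the two opposite forms have the
    -- same kernel.
    · exact ⟨d, w, (hadj d w).mp h.symm, by rw [hsymm, hcomap]⟩
    · exact h.elim

open scoped Classical in
-- A general index type D covers both the coordinates y_i^{(l)} and the single y_i of the Linial
-- case.
theorem X_mul_charPolynomial_homogenized {k : ℕ} (hk : 1 ≤ k) (hn : 1 ≤ n) (p : D → Fin n)
    (hp : ∀ i, (Finset.univ.filter fun d => p d = i).card = k) :
    X * charPolynomial (IntersectionPoset ((Finset.univ.filter fun z : D × Fin (n + 1) =>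
        (p z.1).castSucc < z.2).image fun z => hyperplane
          (coord (Sum.inl (p z.1).castSucc) - coord (Sum.inl z.2) - coord (Sum.inr z.1)))) =
      ∑ d ∈ Finset.range (n + 1), staircaseCount k n d := by
  obtain ⟨e⟩ := nonempty_orderIso_bondLattice p
  rw [← charPolynomial_orderIso e]
  exact X_mul_charPolynomial_of_iso hk hn (isStaircase_homogenizedRow p hp) (SimpleGraph.Iso.refl)

end Homogenized

/-! ### The graphs Γ_V, with even elements as rows -/

section Gamma

/-- The odd elements of `V` that are smaller than a given even element. -/
def gammaRow (V : Finset ℕ) (b : {x : V // Even x.1}) : Finset {x : V // ¬ Even x.1} :=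
  Finset.univ.filter fun a => a.1.1 < b.1.1

/-- The graph `Γ_V` as a bipartite graph between even and odd elements. -/
def gammaGraphIso (V : Finset ℕ) : gammaGraph V ≃g bipartiteGraph (gammaRow V) where
  toEquiv := (Equiv.sumCompl fun x : V => Even x.1).symm
  map_rel_iff' := by
    intro v w
    obtain ⟨v, rfl⟩ := (Equiv.sumCompl fun x : V => Even x.1).surjective v
    obtain ⟨w, rfl⟩ := (Equiv.sumCompl fun x : V => Even x.1).surjective w
    rw [Equiv.symm_apply_apply, Equiv.symm_apply_apply]
    rcases v with ⟨v, hv⟩ | ⟨v, hv⟩ <;> rcases w with ⟨w, hw⟩ | ⟨w, hw⟩ <;>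
      simp [bipartiteGraph, gammaGraph, gammaRow, hv, hw, ← Nat.not_even_iff_odd]

theorem isStaircase_gammaRow {k n : ℕ} (hk : 1 ≤ k) {V : Finset ℕ}
    (hV : partitionType V = kStaircase k n) : IsStaircase k n (gammaRow V) := by
  refine isStaircase_of_chain hk (fun b b' => ?_) ?_
  · rcases le_total b.1.1 b'.1.1 with h | h
    · exact Or.inl (Finset.monotone_filter_right _ fun _ _ ha => lt_of_lt_of_le ha h)
    · exact Or.inr (Finset.monotone_filter_right _ fun _ _ ha => lt_of_lt_of_le ha h)
  · rw [← hV, partitionType]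
    congr 1
    let ι : {x : V // Even x.1} ↪ ℕ :=
      ⟨fun b => b.1.1, fun _ _ h => Subtype.ext (Subtype.ext h)⟩
    have hmap : V.filter (fun b => Even b) = Finset.univ.map ι := by
      ext b
      simp only [Finset.mem_filter, Finset.mem_map, Finset.mem_univ, true_and]
      exact ⟨fun h => ⟨⟨⟨b, h.1⟩, h.2⟩, rfl⟩, by rintro ⟨c, rfl⟩; exact ⟨c.1.2, c.2⟩⟩
    rw [hmap, Finset.map_val, Multiset.map_map]
    refine Multiset.map_congr rfl fun b _ => ?_
    let ι' : {x : V // ¬ Even x.1} ↪ ℕ :=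
      ⟨fun a => a.1.1, fun _ _ h => Subtype.ext (Subtype.ext h)⟩
    rw [Function.comp_apply, ← Finset.card_map ι']
    congr 1
    ext a
    simp only [gammaRow, Finset.mem_map, Finset.mem_filter, Finset.mem_univ, true_and,
      ← Nat.not_even_iff_odd]
    constructor
    · rintro ⟨a, hlt, rfl⟩
      exact ⟨a.1.2, a.2, hlt⟩
    · rintro ⟨ha, hodd, hlt⟩
      exact ⟨⟨⟨a, ha⟩, hodd⟩, hlt, rfl⟩

end Gamma

/-! ### Ferrers graphs -/

section Ferrers

variable {W : Type*} {G : SimpleGraph W} (F : FerrersStructure G)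

open scoped Classical in
/-- The neighborhood of a row of a Ferrers graph, as a set of column indices. -/
def FerrersStructure.row (i : Fin (F.a + 1)) : Finset (Fin (F.b + 1)) :=
  Finset.univ.filter fun j => G.Adj (F.r i) (F.c j)

/-- A Ferrers graph as a bipartite graph between its rows and columns. -/
def FerrersStructure.iso : bipartiteGraph F.row ≃g G where
  toEquiv := Equiv.ofBijective _ F.bijective
  map_rel_iff' := by
    rintro (i | j) (i' | j')
    · simp [bipartiteGraph, F.not_adj_r]
    · simp [bipartiteGraph, FerrersStructure.row]
    · simp [bipartiteGraph, FerrersStructure.row, G.adj_comm]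
    · simp [bipartiteGraph, F.not_adj_c]

theorem FerrersStructure.ncard_neighborSet (i : Fin (F.a + 1)) :
    (G.neighborSet (F.r i)).ncard = (F.row i).card := by
  classical
  have hc : Function.Injective F.c := F.bijective.1.comp Sum.inr_injective
  have : G.neighborSet (F.r i) = ((F.row i).map ⟨F.c, hc⟩ : Finset W) := by
    ext w
    simp only [SimpleGraph.mem_neighborSet, Finset.coe_map, Function.Embedding.coeFn_mk,
      Set.mem_image, Finset.mem_coe, FerrersStructure.row, Finset.mem_filter, Finset.mem_univ,
      true_and]
    constructor
    · intro h
      obtain ⟨v, rfl⟩ := F.bijective.2 w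
      rcases v with i' | j
      · exact (F.not_adj_r _ _ h).elim
      · exact ⟨j, h, rfl⟩
    · rintro ⟨j, hj, rfl⟩
      exact hj
  rw [this, Set.ncard_coe_finset, Finset.card_map]

theorem FerrersStructure.isStaircase_row {k n : ℕ} (hk : 1 ≤ k)
    (hF : F.partition = kStaircase k n) : IsStaircase k n F.row := by
  classical
  refine isStaircase_of_chain hk (fun i i' => ?_) ?_
  · rcases le_total i i' with h | h
    · exact Or.inl (Finset.monotone_filter_right _ fun j _ hj => F.adj_of_adj i j i' j hj h le_rfl)
    · exact Or.inr (Finset.monotone_filter_right _ fun j _ hj => F.adj_of_adj i' j i j hj h le_rfl)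
  · rw [← kStaircase_filter hk n, ← hF, FerrersStructure.partition]
    simp only [F.ncard_neighborSet]

/-- No vertex is isolated: every row is joined to the first column and every column to the last row.
So the power of X is trivial. -/
theorem FerrersStructure.chromaticPolynomial_eq [Fintype W] {k n : ℕ} (hk : 1 ≤ k)
    (hF : F.partition = kStaircase k n) :
    chromaticPolynomial G = ∑ d ∈ Finset.range (n + 1), staircaseCount k n d := by
  have hempty : IsEmpty {v // ∀ w, ¬ (bipartiteGraph F.row).Adj v w} := by
    refine ⟨?_⟩
    rintro ⟨i | j, h⟩
    · exact h (.inr 0) (F.iso.map_adj_iff.mp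
        (F.adj_of_adj 0 0 i 0 F.adj_first (Fin.zero_le i) le_rfl))
    · exact h (.inl (Fin.last _)) (F.iso.map_adj_iff.mp
        (F.adj_of_adj _ _ _ j F.adj_last le_rfl (Fin.le_last j)).symm)
  rw [← chromaticPolynomial_iso F.iso,
    chromaticPolynomial_bipartiteGraph hk (F.isStaircase_row hk hF),
    Nat.card_of_isEmpty, pow_zero, one_mul]

end Ferrers


end

theorem theorem5p1 :
    (∀ k : ℕ, 1 ≤ k →
      -- the bond lattices of the graphs `Γ_V`
      (∀ V : ℕ → Finset ℕ,
        (∀ n, 1 ≤ n → (∀ x ∈ V n, 0 < x) ∧ partitionType (V n) = kStaircase k n) →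
        GenFunEq (fun n => charPolynomial (BondLattice (gammaGraph (V n))))
          (fun n => staircaseTerm k
            (fallingFactorial (X - 1) (n - 1) * fallingFactorial (X - 1) n ^ k) n)) ∧
      -- the chromatic polynomials of Ferrers graphs
      (∀ (W : ℕ → Type*) [∀ n, Fintype (W n)] (G : ∀ n, SimpleGraph (W n)),
        (∀ n, 1 ≤ n → ∃ F : FerrersStructure (G n), F.partition = kStaircase k n) →
        GenFunEq (fun n => chromaticPolynomial (G n))
          (fun n => staircaseTerm k
            (fallingFactorial X n * fallingFactorial (X - 1) n ^ k) n)) ∧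
      -- the homogenized `(k, …, k)`-arrangements
      GenFunEq
        (fun n => charPolynomial
          (IntersectionPoset (homogenizedArrangement (fun _ : Fin n => k))))
        (fun n => staircaseTerm k
          (fallingFactorial (X - 1) (n - 1) * fallingFactorial (X - 1) n ^ k) n)) ∧
    -- the case `k = 1`: the homogenized Linial arrangements
    GenFunEq
      (fun n => charPolynomial (IntersectionPoset (homogenizedLinialArrangement n)))
      (fun n => staircaseTerm 1
        (fallingFactorial (X - 1) (n - 1) * fallingFactorial (X - 1) n) n) := by
  classical
  refine ⟨fun k hk => ⟨fun V hV => ?_, fun W _ G hG => ?_, ?_⟩, ?_⟩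
  · exact genFunEq_staircase_of_X_mul fun n hn =>
      X_mul_charPolynomial_of_iso hk hn (isStaircase_gammaRow hk (hV n hn).2) (gammaGraphIso (V n))
  · refine genFunEq_staircase fun n hn => ?_
    obtain ⟨F, hF⟩ := hG n hn
    exact F.chromaticPolynomial_eq hk hF
  · refine genFunEq_staircase_of_X_mul fun n hn =>
      X_mul_charPolynomial_homogenized hk hn (Sigma.fst : (Σ _ : Fin n, Fin k) → Fin n)
        fun i => ?_
    rw [← Fintype.card_subtype, Fintype.card_congr (Equiv.sigmaSubtype i), Fintype.card_fin]
  -- Here D is `Fin n` itself with the identity as index map, so all fibers are singletons.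
  · have h := genFunEq_staircase_of_X_mul (k := 1) fun n hn =>
      X_mul_charPolynomial_homogenized le_rfl hn (id : Fin n → Fin n) fun i =>
        Finset.card_eq_one.mpr ⟨i, by ext; simp⟩
    simp only [pow_one] at h
    exact h
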